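/- Let $(R,\mathfrak m)$ be a Noetherian local ring and let $M$ be an $R$-module of finite length and of infinite projective dimension. Let $$\cdots\to G_{2}\xrightarrow{\varphi_2} G_1\xrightarrow{\varphi_1} G_0\to M\to 0$$ be a minimal free resolution of $M$, that is, an exact sequence with all $G_i$ finitely generated free $R$-modules and $\varphi_{i+1}(G_{i+1})\subseteq\mathfrak m G_i$ for all $i\ge 0$. Let $\beta_i=\operatorname{rank} G_i$ be the Betti numbers of $M$, and let $\Omega_i=\operatorname{Coker}(\varphi_{i+1})$ be its $i$-th syzygy (so that $\Omega_0\cong M$). Assume that the Betti numbers are eventually non-decreasing: there is $n$ with $\beta_i\le\beta_{i+1}$ for all $i\ge n$. Then there is $N$ such that for every $i\ge N$ there exists a minimal prime $\mathfrak p$ of $R$ with $$\dim \Omega_i=\dim R/\mathfrak p ,$$ where the dimension of a finitely generated module is the Krull dimension of its support (equivalently, of $R$ modulo its annihilator). In particular, if $\dim R>0$, then $M$ does not have arbitrarily high syzygies of finite length: it is not the case that for every $N$ there is $i\ge N$ such that $\Omega_i$ has finite length. -/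

import Mathlib

universe u v

/-- A minimal free resolution `⋯ ⟶ G 2 ⟶ G 1 ⟶ G 0 ⟶ M ⟶ 0` of a module `M` over a local
ring `R`: an exact sequence of finitely generated free modules `G i` such that the image of each
differential `d i : G (i + 1) ⟶ G i` lies in `𝔪 • G i`. -/
structure MinimalFreeResolution (R : Type u) [CommRing R] [IsLocalRing R]
    (M : Type v) [AddCommGroup M] [Module R M] where
  /-- The free modules of the resolution. -/
  G : ℕ → Type v
  [addCommGroup : ∀ i, AddCommGroup (G i)]
  [module : ∀ i, Module R (G i)]
  [free : ∀ i, Module.Free R (G i)]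
  [finite : ∀ i, Module.Finite R (G i)]
  /-- The differentials. -/
  d : ∀ i, G (i + 1) →ₗ[R] G i
  /-- The augmentation. -/
  aug : G 0 →ₗ[R] M
  aug_surjective : Function.Surjective aug
  exact_aug : Function.Exact (d 0) aug
  exact_d : ∀ i, Function.Exact (d (i + 1)) (d i)
  minimal : ∀ i, LinearMap.range (d i) ≤
    IsLocalRing.maximalIdeal R • (⊤ : Submodule R (G i))

namespace MinimalFreeResolution

attribute [instance] addCommGroup module free finite

variable {R : Type u} [CommRing R] [IsLocalRing R] {M : Type v} [AddCommGroup M] [Module R M]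

/-- The `i`-th Betti number of `M`: the rank of the `i`-th free module. -/
noncomputable def betti (F : MinimalFreeResolution R M) (i : ℕ) : ℕ :=
  Module.finrank R (F.G i)

/-- The `i`-th syzygy `Ω_i` of `M`: the cokernel of `d i : G (i + 1) ⟶ G i`. By exactness
`Ω_0` is isomorphic to `M`, and `Ω_(i+1)` is isomorphic to the image of `d i` in `G i`. -/
abbrev syzygy (F : MinimalFreeResolution R M) (i : ℕ) : Type v :=
  F.G i ⧸ LinearMap.range (F.d i)

end MinimalFreeResolution

/-! Away from the closed point `M` localizes to zero, so the localized resolution splits and each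
`Ω_i` becomes free of a rank `r i` given by `r 0 = 0` and `r i + r (i + 1) = β_i`, the same at every
non-maximal prime. Hence `r i > 0` forces full support, and `Ω_i` then has dimension `dim R`,
attained on a minimal prime; `r i = 0` forces finite length. If every prime is maximal, a nonzero
syzygy has full support anyway.

It remains to see that `r` is eventually positive. Since `r (i + 2) - r i = β_(i+1) - β_i`, it is
eventually non-decreasing along each parity class, so it suffices that it does not vanish on a whole
tail `j, j + 2, ...`. If it did, each `d i` on the tail would be square, with cokernel `Ω_i` of
finite length and kernel isomorphic to `Ω_(i+2)`. By `LinearMap.length_ker_lt_length_coker` the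
lengths would decrease forever.

That inequality comes from the Euler characteristic `length coker (f ⊗ N) - length ker (f ⊗ N)`,
which is additive in `N`. By prime filtration only `N = R/p` matters: it is zero for `p` maximal and
positive otherwise, where `f ⊗ N` is injective and not surjective. A ring of infinite length has a
factor of the second kind. -/

/-! ### Lengths in exact sequences -/

open LinearMap in
theorem Module.length_eq_length_range_add_length_range {R : Type*} [Ring R] {A B C : Type*}
    [AddCommGroup A] [AddCommGroup B] [AddCommGroup C] [Module R A] [Module R B] [Module R C]
    {f : A →ₗ[R] B} {g : B →ₗ[R] C} (h : Function.Exact f g) :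
    Module.length R B = Module.length R (range f) + Module.length R (range g) :=
  Module.length_eq_add_of_exact (range f).subtype g.rangeRestrict (range f).injective_subtype
    g.surjective_rangeRestrict fun y => by
      rw [Subtype.ext_iff]
      change g y = 0 ↔ _
      rw [h y]
      simp

open LinearMap in
/-- The alternating sum of the lengths in an exact sequence
`0 ⟶ A ⟶ B ⟶ C ⟶ D ⟶ E ⟶ F ⟶ 0` vanishes. -/
theorem Module.length_add_eq_of_exact_six {R : Type*} [Ring R] {A B C D E F : Type*}
    [AddCommGroup A] [AddCommGroup B] [AddCommGroup C] [AddCommGroup D] [AddCommGroup E]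
    [AddCommGroup F] [Module R A] [Module R B] [Module R C] [Module R D] [Module R E] [Module R F]
    (f₁ : A →ₗ[R] B) (f₂ : B →ₗ[R] C) (f₃ : C →ₗ[R] D) (f₄ : D →ₗ[R] E) (f₅ : E →ₗ[R] F)
    (h₁ : Function.Injective f₁) (h₅ : Function.Surjective f₅)
    (h₁₂ : Function.Exact f₁ f₂) (h₂₃ : Function.Exact f₂ f₃) (h₃₄ : Function.Exact f₃ f₄)
    (h₄₅ : Function.Exact f₄ f₅) :
    Module.length R B + Module.length R D + Module.length R F =
      Module.length R A + Module.length R C + Module.length R E := by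
  rw [Module.length_eq_length_range_add_length_range h₁₂,
    Module.length_eq_length_range_add_length_range h₂₃,
    Module.length_eq_length_range_add_length_range h₃₄,
    Module.length_eq_length_range_add_length_range h₄₅,
    (LinearEquiv.ofInjective f₁ h₁).length_eq, range_eq_top.2 h₅, Module.length_top]
  ring

open LinearMap in
-- The snake lemma gives a six-term exact sequence of kernels and cokernels. The equation is stated
-- without subtraction because lengths may be infinite.
theorem Module.length_ker_add_length_coker {R : Type*} [CommRing R] {M₁ M₂ M₃ N₁ N₂ N₃ : Type*}
    [AddCommGroup M₁] [Module R M₁] [AddCommGroup M₂] [Module R M₂] [AddCommGroup M₃] [Module R M₃]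
    [AddCommGroup N₁] [Module R N₁] [AddCommGroup N₂] [Module R N₂] [AddCommGroup N₃] [Module R N₃]
    (i₁ : M₁ →ₗ[R] N₁) (i₂ : M₂ →ₗ[R] N₂) (i₃ : M₃ →ₗ[R] N₃)
    (f₁ : M₁ →ₗ[R] M₂) (f₂ : M₂ →ₗ[R] M₃) (hf : Function.Exact f₁ f₂)
    (g₁ : N₁ →ₗ[R] N₂) (g₂ : N₂ →ₗ[R] N₃) (hg : Function.Exact g₁ g₂)
    (h₁ : g₁.comp i₁ = i₂.comp f₁) (h₂ : g₂.comp i₂ = i₃.comp f₂)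
    (hf₁ : Function.Injective f₁) (hf₂ : Function.Surjective f₂)
    (hg₁ : Function.Injective g₁) (hg₂ : Function.Surjective g₂) :
    Module.length R (ker i₂) + Module.length R (N₁ ⧸ range i₁) + Module.length R (N₃ ⧸ range i₃) =
      Module.length R (ker i₁) + Module.length R (ker i₃) + Module.length R (N₂ ⧸ range i₂) := by
  have e₁ (x) : g₁ (i₁ x) = i₂ (f₁ x) := LinearMap.congr_fun h₁ x
  have e₂ (x) : g₂ (i₂ x) = i₃ (f₂ x) := LinearMap.congr_fun h₂ x
  let k₁ : ker i₁ →ₗ[R] ker i₂ := f₁.restrict fun x hx => by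
    rw [mem_ker] at hx ⊢; rw [← e₁, hx, map_zero]
  let k₂ : ker i₂ →ₗ[R] ker i₃ := f₂.restrict fun x hx => by
    rw [mem_ker] at hx ⊢; rw [← e₂, hx, map_zero]
  let c₁ : (N₁ ⧸ range i₁) →ₗ[R] (N₂ ⧸ range i₂) := (range i₁).mapQ (range i₂) g₁ <| by
    rintro _ ⟨x, rfl⟩; exact ⟨f₁ x, (e₁ x).symm⟩
  let c₂ : (N₂ ⧸ range i₂) →ₗ[R] (N₃ ⧸ range i₃) := (range i₂).mapQ (range i₃) g₂ <| by
    rintro _ ⟨x, rfl⟩; exact ⟨f₂ x, (e₂ x).symm⟩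
  let δ := SnakeLemma.δ' i₁ i₂ i₃ f₁ f₂ hf g₁ g₂ hg h₁ h₂ (ker i₃).subtype
    (LinearMap.exact_subtype_ker_map i₃) (range i₁).mkQ (LinearMap.exact_map_mkQ_range i₁) hf₂ hg₁
  refine Module.length_add_eq_of_exact_six k₁ k₂ δ c₁ c₂ ?_ ?_ ?_ ?_ ?_ ?_
  · intro x y h
    exact Subtype.ext (hf₁ (congrArg Subtype.val h))
  · intro y
    obtain ⟨y, rfl⟩ := Submodule.mkQ_surjective _ y
    obtain ⟨x, rfl⟩ := hg₂ y
    exact ⟨(range i₂).mkQ x, rfl⟩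
  · rintro ⟨y, hy⟩
    constructor
    · intro h
      obtain ⟨x, rfl⟩ := (hf y).1 (congrArg Subtype.val h)
      refine ⟨⟨x, hg₁ ?_⟩, rfl⟩
      rw [e₁, map_zero]; exact hy
    · rintro ⟨x, hx⟩
      exact Subtype.ext ((hf y).2 ⟨x, congrArg Subtype.val hx⟩)
  · exact SnakeLemma.exact_δ'_right _ _ _ _ _ _ _ _ _ _ _ (ker i₂).subtype
      (LinearMap.exact_subtype_ker_map i₂) _ _ _ _ hf₂ hg₁ k₂ rfl (ker i₃).injective_subtype
  · exact SnakeLemma.exact_δ'_left _ _ _ _ _ _ _ _ _ _ _ _ _ _ _ (range i₂).mkQ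
      (LinearMap.exact_map_mkQ_range i₂) hf₂ hg₁ c₁ rfl (Submodule.mkQ_surjective _)
  · intro y
    obtain ⟨y, rfl⟩ := Submodule.mkQ_surjective _ y
    constructor
    · intro h
      obtain ⟨z, hz⟩ := (Submodule.Quotient.mk_eq_zero _).1 (show (range i₃).mkQ (g₂ y) = 0 from h)
      obtain ⟨w, rfl⟩ := hf₂ z
      obtain ⟨x, hx⟩ := (hg (y - i₂ w)).1 (by rw [map_sub, e₂, hz, sub_self])
      refine ⟨(range i₁).mkQ x, ?_⟩
      change (range i₂).mkQ (g₁ x) = _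
      rw [hx, map_sub, sub_eq_self]
      exact (Submodule.Quotient.mk_eq_zero _).2 ⟨w, rfl⟩
    · rintro ⟨x, hx⟩
      obtain ⟨x, rfl⟩ := Submodule.mkQ_surjective _ x
      rw [← hx]
      change (range i₃).mkQ (g₂ (g₁ x)) = 0
      rw [hg.apply_apply_eq_zero, map_zero]

/-! ### Finite length via the support; dimension and minimal primes -/

theorem IsFiniteLength.isMaximal_of_mem_support {R : Type u} [CommRing R]
    {M : Type v} [AddCommGroup M] [Module R M] (h : IsFiniteLength R M) :
    ∀ p ∈ Module.support R M, p.asIdeal.IsMaximal := by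
  induction h with
  | of_subsingleton => simp [Module.support_eq_empty]
  | @of_simple_quotient M _ _ N _ _ ih =>
    intro p hp
    rw [Module.support_of_exact (LinearMap.exact_subtype_mkQ N) N.injective_subtype
      N.mkQ_surjective] at hp
    rcases hp with hp | hp
    · exact ih p hp
    · obtain ⟨I, hI, ⟨e⟩⟩ := isSimpleModule_iff_quot_maximal.1
        (inferInstance : IsSimpleModule R (M ⧸ N))
      have hIp := Module.annihilator_le_of_mem_support hp
      rw [e.annihilator_eq, Ideal.annihilator_quotient] at hIp
      rwa [← hI.eq_of_le p.2.ne_top hIp]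

/-- By prime filtration: the factors `R/p` have `p` in the support, so they are simple. -/
theorem IsFiniteLength.of_support_isMaximal {R : Type u} [CommRing R] [IsNoetherianRing R]
    {M : Type v} [AddCommGroup M] [Module R M] [Module.Finite R M]
    (h : ∀ p ∈ Module.support R M, p.asIdeal.IsMaximal) : IsFiniteLength R M := by
  induction ‹Module.Finite R M› using
    IsNoetherianRing.induction_on_isQuotientEquivQuotientPrime R with
  | subsingleton N => exact .of_subsingleton
  | quotient N p e =>
    have : p.asIdeal.IsMaximal := h p <| by
      rw [e.support_eq, Module.mem_support_iff_of_finite, Ideal.annihilator_quotient]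
    have : IsSimpleModule R (R ⧸ p.asIdeal) :=
      isSimpleModule_iff_quot_maximal.2 ⟨_, this, ⟨.refl R _⟩⟩
    rw [isFiniteLength_iff_isNoetherian_isArtinian]
    have : IsSimpleModule R N := IsSimpleModule.congr e
    exact ⟨inferInstance, inferInstance⟩
  | exact N₁ N₂ N₃ f g hf hg hfg h₁ h₃ =>
    rw [Module.support_of_exact hfg hf hg] at h
    rw [← Module.length_ne_top_iff, Module.length_eq_add_of_exact f g hf hg hfg]
    exact WithTop.add_ne_top.2 ⟨Module.length_ne_top_iff.2 (h₁ fun p hp => h p (.inl hp)),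
      Module.length_ne_top_iff.2 (h₃ fun p hp => h p (.inr hp))⟩

/-- A chain of primes of maximal length lies above a minimal prime contained in its first member. -/
theorem ringKrullDim_quotient_eq_of_finite (R : Type u) [CommRing R] [FiniteRingKrullDim R] :
    ∃ p ∈ minimalPrimes R, ringKrullDim (R ⧸ p) = ringKrullDim R := by
  obtain ⟨s, hs⟩ : ∃ s : LTSeries (PrimeSpectrum R), ringKrullDim R = s.length :=
    ⟨_, Order.krullDim_eq_length_of_finiteDimensionalOrder⟩
  obtain ⟨p, hp, hps⟩ := Ideal.exists_minimalPrimes_le (bot_le : (⊥ : Ideal R) ≤ s.head.asIdeal)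
  refine ⟨p, hp, le_antisymm (ringKrullDim_quotient_le p) ?_⟩
  rw [hs, ringKrullDim_quotient]
  let t : LTSeries (PrimeSpectrum.zeroLocus (p : Set R)) := LTSeries.mk s.length
    (fun i => ⟨s i, hps.trans (s.strictMono.monotone (Fin.zero_le i))⟩)
    (fun i j h => s.strictMono h)
  exact Order.LTSeries.length_le_krullDim t

/-! ### Euler characteristic of a square matrix tensored with a module -/

section
open TensorProduct LinearMap

theorem Module.End.exists_comp_eq_det_smul {R : Type u} [CommRing R] {G : Type v} [AddCommGroup G]
    [Module R G] [Module.Free R G] [Module.Finite R G] (f : Module.End R G) :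
    ∃ g : Module.End R G, g ∘ₗ f = LinearMap.det f • LinearMap.id := by
  classical
  let b := Module.Free.chooseBasis R G
  refine ⟨Matrix.toLin b b (LinearMap.toMatrix b b f).adjugate, ?_⟩
  apply (LinearMap.toMatrix b b).injective
  rw [LinearMap.toMatrix_comp b b b, LinearMap.toMatrix_toLin, Matrix.adjugate_mul, map_smul,
    LinearMap.toMatrix_id, LinearMap.det_toMatrix]

/-- If the cokernel of an endomorphism of a finite free module is killed by some element outside
the prime `p`, then the determinant is outside `p`. -/
theorem LinearMap.det_notMem_of_smul_mem_range {R : Type u} [CommRing R] {G : Type v}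
    [AddCommGroup G] [Module R G] [Module.Free R G] [Module.Finite R G] (f : Module.End R G)
    (p : Ideal R) [p.IsPrime] {s : R} (hs : s ∉ p) (h : ∀ x : G, s • x ∈ range f) :
    LinearMap.det f ∉ p := by
  -- Lifting `s • id` through `f` gives `f ∘ g = s • id`, so `det f` divides a power of `s`.
  obtain ⟨g, hg⟩ := Module.projective_lifting_property f.rangeRestrict
    ((s • LinearMap.id : Module.End R G).codRestrict (range f) h) f.surjective_rangeRestrict
  have hg' : f ∘ₗ g = s • LinearMap.id := by
    ext x
    exact congrArg Subtype.val (LinearMap.congr_fun hg x)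
  intro hf
  have h1 : LinearMap.det f * LinearMap.det g = s ^ Module.finrank R G := by
    rw [← LinearMap.det_comp, hg', LinearMap.det_smul, LinearMap.det_id, mul_one]
  exact hs (‹p.IsPrime›.mem_of_pow_mem _ (h1 ▸ p.mul_mem_right _ hf))

/-- The adjugate composed with `f` is multiplication by `det f`, which is injective on the domain
`R/p`, and remains so after tensoring with the flat module `G`. -/
theorem LinearMap.rTensor_injective_of_det_notMem {R : Type u} [CommRing R] {G : Type v}
    [AddCommGroup G] [Module R G] [Module.Free R G] [Module.Finite R G] (f : Module.End R G)
    (p : Ideal R) [p.IsPrime] (hf : LinearMap.det f ∉ p) {N : Type*} [AddCommGroup N]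
    [Module R N] (e : N ≃ₗ[R] R ⧸ p) : Function.Injective (f.rTensor N) := by
  obtain ⟨g, hg⟩ := f.exists_comp_eq_det_smul
  have hN : Function.Injective (LinearMap.lsmul R N (LinearMap.det f)) := by
    rw [injective_iff_map_eq_zero]
    intro x hx
    have := congrArg e hx
    rw [LinearMap.lsmul_apply, map_smul, map_zero] at this
    obtain ⟨y, hy⟩ := Ideal.Quotient.mk_surjective (e x)
    rw [← hy, ← Ideal.Quotient.mk_eq_mk, ← Submodule.Quotient.mk_smul, Submodule.Quotient.mk_eq_zero,
      smul_eq_mul] at this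
    rw [← e.map_eq_zero_iff, ← hy, Ideal.Quotient.eq_zero_iff_mem]
    exact (‹p.IsPrime›.mem_or_mem this).resolve_left hf
  have hG := Module.Flat.lTensor_preserves_injective_linearMap (M := G) _ hN
  have : g.rTensor N ∘ₗ f.rTensor N = (LinearMap.lsmul R N (LinearMap.det f)).lTensor G := by
    rw [← LinearMap.rTensor_comp, hg]
    ext x y
    simp
  rw [← this] at hG
  exact Function.Injective.of_comp hG

theorem LinearMap.isFiniteLength_coker_rTensor {R : Type u} [CommRing R] [IsNoetherianRing R]
    {G : Type v} [AddCommGroup G] [Module R G] [Module.Finite R G] (f : Module.End R G)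
    (hf : IsFiniteLength R (G ⧸ range f)) (N : Type*) [AddCommGroup N] [Module R N]
    [Module.Finite R N] : IsFiniteLength R ((G ⊗[R] N) ⧸ range (f.rTensor N)) := by
  refine .of_support_isMaximal fun p hp => hf.isMaximal_of_mem_support p ?_
  rw [Module.mem_support_iff_of_finite] at hp ⊢
  refine le_trans (fun s hs => Module.mem_annihilator.2 fun y => ?_) hp
  obtain ⟨y, rfl⟩ := Submodule.mkQ_surjective _ y
  rw [← map_smul, Submodule.mkQ_apply, Submodule.Quotient.mk_eq_zero]
  induction y with
  | zero => rw [smul_zero]; exact zero_mem _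
  | add x y hx hy => rw [smul_add]; exact add_mem hx hy
  | tmul x n =>
    have := Module.mem_annihilator.1 hs (Submodule.Quotient.mk x)
    rw [← Submodule.Quotient.mk_smul, Submodule.Quotient.mk_eq_zero] at this
    obtain ⟨z, hz⟩ := this
    exact ⟨z ⊗ₜ n, by rw [LinearMap.rTensor_tmul, hz, TensorProduct.smul_tmul']⟩

/-- Nakayama: the image lies in `𝔪 (G ⊗ N)`, and `G ⊗ N` is nonzero by faithful flatness. -/
theorem LinearMap.nontrivial_coker_rTensor {R : Type u} [CommRing R] [IsLocalRing R]
    {G : Type v} [AddCommGroup G] [Module R G] [Module.Free R G]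
    [Module.Finite R G] [Nontrivial G] (f : Module.End R G)
    (hf : range f ≤ IsLocalRing.maximalIdeal R • (⊤ : Submodule R G))
    (N : Type*) [AddCommGroup N] [Module R N] [Module.Finite R N] [Nontrivial N] :
    Nontrivial ((G ⊗[R] N) ⧸ range (f.rTensor N)) := by
  have : Nontrivial (G ⊗[R] N) := Module.FaithfullyFlat.lTensor_nontrivial R G N
  rw [Submodule.Quotient.nontrivial_iff]
  intro h
  have hle : range (f.rTensor N) ≤
      IsLocalRing.maximalIdeal R • (⊤ : Submodule R (G ⊗[R] N)) := by
    rintro _ ⟨y, rfl⟩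
    induction y with
    | zero => rw [map_zero]; exact zero_mem _
    | add x y hx hy => rw [map_add]; exact add_mem hx hy
    | tmul x n =>
      exact Submodule.smul_top_le_comap_smul_top _ ((TensorProduct.mk R G N).flip n)
        (hf ⟨x, rfl⟩)
  have := Submodule.eq_bot_of_le_smul_of_le_jacobson_bot (IsLocalRing.maximalIdeal R)
    (⊤ : Submodule R (G ⊗[R] N)) Module.Finite.fg_top (h ▸ hle)
    (IsLocalRing.maximalIdeal_le_jacobson _)
  exact absurd this top_ne_bot

/-- Let `f` be an endomorphism of a nonzero finite free module over a Noetherian local ring, with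
nonzero cokernel of finite length. Then `f ⊗ N` has cokernel of finite length, which is at least the
length of its kernel, and greater than it if `N` is not of finite length. -/
theorem LinearMap.length_ker_rTensor_le {R : Type u} [CommRing R] [IsLocalRing R]
    [IsNoetherianRing R] {G : Type v} [AddCommGroup G] [Module R G] [Module.Free R G]
    [Module.Finite R G] (f : Module.End R G) (hf : IsFiniteLength R (G ⧸ range f))
    (hf' : range f ≤ IsLocalRing.maximalIdeal R • (⊤ : Submodule R G)) [Nontrivial G]
    (N : Type u) [AddCommGroup N] [Module R N] [Module.Finite R N] :
    Module.length R ((G ⊗[R] N) ⧸ range (f.rTensor N)) ≠ ⊤ ∧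
    Module.length R (ker (f.rTensor N)) ≤ Module.length R ((G ⊗[R] N) ⧸ range (f.rTensor N)) ∧
    (Module.length R N = ⊤ →
      Module.length R (ker (f.rTensor N)) < Module.length R ((G ⊗[R] N) ⧸ range (f.rTensor N))) := by
  induction ‹Module.Finite R N› using
    IsNoetherianRing.induction_on_isQuotientEquivQuotientPrime R with
  | subsingleton N =>
    have : Subsingleton (G ⊗[R] N) := inferInstance
    simp
  | quotient N p e =>
    by_cases hp : p.asIdeal.IsMaximal
    · have hN : IsSimpleModule R N :=
        have : IsSimpleModule R (R ⧸ p.asIdeal) :=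
          isSimpleModule_iff_quot_maximal.2 ⟨_, hp, ⟨.refl R _⟩⟩
        IsSimpleModule.congr e
      -- `G ⊗ N` is a finite power of the simple module `N`, so kernel and cokernel of its
      -- endomorphism have equal finite length.
      have hGN : Module.length R (G ⊗[R] N) ≠ ⊤ := by
        let b := Module.Free.chooseBasis R G
        rw [(TensorProduct.congr b.equivFun (.refl R N) ≪≫ₗ TensorProduct.comm R _ _ ≪≫ₗ
          TensorProduct.piScalarRight R R N _).length_eq, Module.length_pi]
        simp [Module.length_eq_one, ENat.card_eq_coe_fintype_card]
      have h1 := Module.length_eq_add_of_exact _ _ (ker (f.rTensor N)).injective_subtype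
        (f.rTensor N).surjective_rangeRestrict (fun y => by rw [Subtype.ext_iff]; simp)
      have h2 := Module.length_eq_add_of_exact _ _ (range (f.rTensor N)).injective_subtype
        (range (f.rTensor N)).mkQ_surjective (exact_subtype_mkQ _)
      have h3 : Module.length R (range (f.rTensor N)) ≠ ⊤ := fun h => hGN (by rw [h2, h, top_add])
      have h4 : Module.length R ((G ⊗[R] N) ⧸ range (f.rTensor N)) ≠ ⊤ :=
        fun h => hGN (by rw [h2, h, add_top])
      refine ⟨h4, ?_, fun h => absurd h (Module.length_ne_top)⟩
      rw [h1, add_comm] at h2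
      exact ((WithTop.add_left_inj h3).1 h2).le
    · have hpf : p ∉ Module.support R (G ⧸ range f) := fun h => hp (hf.isMaximal_of_mem_support p h)
      rw [Module.mem_support_iff_of_finite, SetLike.not_le_iff_exists] at hpf
      obtain ⟨s, hs, hsp⟩ := hpf
      have hinj := f.rTensor_injective_of_det_notMem p.asIdeal
        (f.det_notMem_of_smul_mem_range p.asIdeal hsp fun x => by
          rw [← Submodule.Quotient.mk_eq_zero, Submodule.Quotient.mk_smul]
          exact Module.mem_annihilator.1 hs _) e
      have hker : Module.length R (ker (f.rTensor N)) = 0 := by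
        rw [ker_eq_bot.2 hinj, Module.length_bot]
      have : Nontrivial N := e.toEquiv.nontrivial
      have hnt := f.nontrivial_coker_rTensor hf' N
      rw [hker]
      exact ⟨Module.length_ne_top_iff.2 (f.isFiniteLength_coker_rTensor hf N), zero_le, fun _ => Module.length_pos⟩
  | exact N₁ N₂ N₃ g₁ g₂ hg₁ hg₂ hg ih₁ ih₃ =>
    have key := Module.length_ker_add_length_coker (f.rTensor N₁) (f.rTensor N₂) (f.rTensor N₃)
      (g₁.lTensor G) (g₂.lTensor G) (Module.Flat.lTensor_exact G hg) (g₁.lTensor G) (g₂.lTensor G)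
      (Module.Flat.lTensor_exact G hg) (by ext; simp) (by ext; simp)
      (Module.Flat.lTensor_preserves_injective_linearMap _ hg₁) (lTensor_surjective G hg₂)
      (Module.Flat.lTensor_preserves_injective_linearMap _ hg₁) (lTensor_surjective G hg₂)
    have hlen := Module.length_eq_add_of_exact g₁ g₂ hg₁ hg₂ hg
    have hC : Module.length R ((G ⊗[R] N₂) ⧸ range (f.rTensor N₂)) ≠ ⊤ :=
      Module.length_ne_top_iff.2 (f.isFiniteLength_coker_rTensor hf N₂)
    have hadd : Module.length R N₂ = ⊤ → Module.length R N₁ = ⊤ ∨ Module.length R N₃ = ⊤ := by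
      rw [hlen]; exact WithTop.add_eq_top.1
    revert key ih₁ ih₃ hC hadd
    generalize Module.length R (ker (f.rTensor N₁)) = k₁
    generalize Module.length R (ker (f.rTensor N₂)) = k₂
    generalize Module.length R (ker (f.rTensor N₃)) = k₃
    generalize Module.length R ((G ⊗[R] N₁) ⧸ range (f.rTensor N₁)) = c₁
    generalize Module.length R ((G ⊗[R] N₂) ⧸ range (f.rTensor N₂)) = c₂
    generalize Module.length R ((G ⊗[R] N₃) ⧸ range (f.rTensor N₃)) = c₃
    rintro ⟨h1, h1', h1''⟩ ⟨h3, h3', h3''⟩ key hC hadd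
    lift c₁ to ℕ using h1
    lift c₃ to ℕ using h3
    lift c₂ to ℕ using hC
    lift k₁ to ℕ using ne_top_of_le_ne_top (by simp) h1'
    lift k₃ to ℕ using ne_top_of_le_ne_top (by simp) h3'
    -- In `key` all the other lengths are already finite.
    have hk₂ : k₂ ≠ ⊤ := by rintro rfl; simp at key; exact absurd key (ENat.natCast_ne_top (k₁ + k₃ + c₂)).symm
    lift k₂ to ℕ using hk₂
    norm_cast at *
    refine ⟨by simp, by omega, fun h => ?_⟩
    rcases hadd h with h | h
    · have := h1'' h; omega
    · have := h3'' h; omega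

theorem LinearMap.length_ker_eq_of_comp_eq {R : Type*} [CommRing R] {M₁ M₂ N₁ N₂ : Type*}
    [AddCommGroup M₁] [AddCommGroup M₂] [AddCommGroup N₁] [AddCommGroup N₂] [Module R M₁]
    [Module R M₂] [Module R N₁] [Module R N₂] {f₁ : M₁ →ₗ[R] N₁} {f₂ : M₂ →ₗ[R] N₂}
    (e : M₁ ≃ₗ[R] M₂) (e' : N₁ ≃ₗ[R] N₂) (h : ∀ x, e' (f₁ x) = f₂ (e x)) :
    Module.length R (ker f₁) = Module.length R (ker f₂) := by
  refine (e.ofSubmodules (ker f₁) (ker f₂) ?_).length_eq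
  ext y
  rw [Submodule.mem_map_equiv, mem_ker, mem_ker, ← e'.map_eq_zero_iff, h, e.apply_symm_apply]

theorem LinearMap.length_coker_eq_of_comp_eq {R : Type*} [CommRing R] {M₁ M₂ N₁ N₂ : Type*}
    [AddCommGroup M₁] [AddCommGroup M₂] [AddCommGroup N₁] [AddCommGroup N₂] [Module R M₁]
    [Module R M₂] [Module R N₁] [Module R N₂] {f₁ : M₁ →ₗ[R] N₁} {f₂ : M₂ →ₗ[R] N₂}
    (e : M₁ ≃ₗ[R] M₂) (e' : N₁ ≃ₗ[R] N₂) (h : ∀ x, e' (f₁ x) = f₂ (e x)) :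
    Module.length R (N₁ ⧸ range f₁) = Module.length R (N₂ ⧸ range f₂) := by
  refine (Submodule.Quotient.equiv (range f₁) (range f₂) e' ?_).length_eq
  ext y
  constructor
  · rintro ⟨_, ⟨x, rfl⟩, rfl⟩
    exact ⟨e x, (h x).symm⟩
  · rintro ⟨x, rfl⟩
    exact ⟨f₁ (e.symm x), ⟨_, rfl⟩, by simp [h]⟩

/-- A minimal map between nonzero free modules of the same rank over a Noetherian local ring of
positive dimension, whose cokernel has finite length, has a kernel of smaller length. -/
theorem LinearMap.length_ker_lt_length_coker {R : Type u} [CommRing R] [IsLocalRing R]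
    [IsNoetherianRing R] (hR : ¬ IsFiniteLength R R) {G₁ G₀ : Type v} [AddCommGroup G₁]
    [AddCommGroup G₀] [Module R G₁] [Module R G₀] [Module.Free R G₁] [Module.Free R G₀]
    [Module.Finite R G₁] [Module.Finite R G₀] [Nontrivial G₀]
    (hrank : Module.finrank R G₁ = Module.finrank R G₀) (f : G₁ →ₗ[R] G₀)
    (hf : IsFiniteLength R (G₀ ⧸ range f))
    (hf' : range f ≤ IsLocalRing.maximalIdeal R • (⊤ : Submodule R G₀)) :
    Module.length R (ker f) < Module.length R (G₀ ⧸ range f) := by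
  let e : G₀ ≃ₗ[R] G₁ := LinearEquiv.ofFinrankEq _ _ hrank.symm
  have hr : range (f ∘ₗ e.toLinearMap) = range f := range_comp_of_range_eq_top _ e.range
  have h := (LinearMap.length_ker_rTensor_le (f ∘ₗ e.toLinearMap) (by rwa [hr]) (by rwa [hr]) R).2.2
    (by rwa [← not_not (a := _ = ⊤), ← ne_eq, Module.length_ne_top_iff])
  have hcomm (x : G₀ ⊗[R] R) : TensorProduct.rid R G₀ ((f ∘ₗ e.toLinearMap).rTensor R x) =
      f ((TensorProduct.rid R G₀ ≪≫ₗ e) x) := by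
    induction x with
    | zero => simp
    | add x y hx hy => simp only [map_add, hx, hy]
    | tmul x y => simp
  rwa [length_ker_eq_of_comp_eq (TensorProduct.rid R G₀ ≪≫ₗ e) (TensorProduct.rid R G₀) hcomm,
    length_coker_eq_of_comp_eq (TensorProduct.rid R G₀ ≪≫ₗ e) (TensorProduct.rid R G₀) hcomm] at h
end

theorem Module.exists_supportDim_eq_of_support_eq_univ {R : Type u} [CommRing R] [IsLocalRing R]
    [IsNoetherianRing R] {M : Type v} [AddCommGroup M] [Module R M]
    (h : Module.support R M = Set.univ) :
    ∃ p ∈ minimalPrimes R, Module.supportDim R M = ringKrullDim (R ⧸ p) := by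
  obtain ⟨p, hp, hpd⟩ := ringKrullDim_quotient_eq_of_finite R
  refine ⟨p, hp, ?_⟩
  rw [hpd, Module.supportDim, h]
  exact Order.krullDim_eq_of_orderIso OrderIso.Set.univ

open TensorProduct in
theorem Module.mem_support_iff_nontrivial_tensorProduct {R : Type u} [CommRing R]
    {M : Type v} [AddCommGroup M] [Module R M] (p : PrimeSpectrum R) :
    p ∈ Module.support R M ↔ Nontrivial (Localization.AtPrime p.asIdeal ⊗[R] M) := by
  rw [Module.mem_support_iff]
  exact (LocalizedModule.equivTensorProduct p.asIdeal.primeCompl M).toEquiv.nontrivial_congr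

/-! ### Syzygies and their ranks on the punctured spectrum -/

namespace MinimalFreeResolution

open LinearMap

variable {R : Type u} [CommRing R] [IsLocalRing R] {M : Type v} [AddCommGroup M] [Module R M]
  (F : MinimalFreeResolution R M)

/-- The map from a syzygy to the preceding free module induced by the differential. -/
def syzygyMap (i : ℕ) : F.syzygy (i + 1) →ₗ[R] F.G i :=
  (range (F.d (i + 1))).liftQ (F.d i) (exact_iff.1 (F.exact_d i)).ge

theorem syzygyMap_injective (i : ℕ) : Function.Injective (F.syzygyMap i) := by
  rw [← ker_eq_bot]
  exact Submodule.ker_liftQ_eq_bot _ _ _ (exact_iff.1 (F.exact_d i)).le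

theorem range_syzygyMap (i : ℕ) : range (F.syzygyMap i) = range (F.d i) :=
  Submodule.range_liftQ _ _ _

theorem exact_syzygyMap_mkQ (i : ℕ) :
    Function.Exact (F.syzygyMap i) (range (F.d i)).mkQ := by
  rw [exact_iff, range_syzygyMap, Submodule.ker_mkQ]

/-- The zeroth syzygy is the resolved module. -/
noncomputable def syzygyZeroEquiv : F.syzygy 0 ≃ₗ[R] M :=
  Submodule.quotEquivOfEq _ _ (exact_iff.1 F.exact_aug).symm ≪≫ₗ
    F.aug.quotKerEquivOfSurjective F.aug_surjective

theorem length_syzygy_add_two (i : ℕ) :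
    Module.length R (F.syzygy (i + 2)) = Module.length R (ker (F.d i)) := by
  rw [(LinearEquiv.ofInjective _ (F.syzygyMap_injective (i + 1))).length_eq, range_syzygyMap,
    exact_iff.1 (F.exact_d i)]

/-- Dimension shifting from `Ω_i = 0` back to `Ω_0 ≅ M` along `0 → Ω_(j+1) → G_j → Ω_j → 0`. -/
theorem hasProjectiveDimensionLT_of_subsingleton [Small.{v} R] {i : ℕ}
    (h : Subsingleton (F.syzygy i)) :
    CategoryTheory.HasProjectiveDimensionLT (ModuleCat.of R M) (i + 1) := by
  have key (k : ℕ) : k ≤ i →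
      CategoryTheory.HasProjectiveDimensionLT (ModuleCat.of R (F.syzygy (i - k))) (k + 1) := by
    induction k with
    | zero =>
      intro _
      have := (ModuleCat.isZero_of_iff_subsingleton (R := R) (M := F.syzygy i)).2 h
      have := this.hasProjectiveDimensionLT_zero
      exact CategoryTheory.hasProjectiveDimensionLT_of_ge _ 0 _ (by simp)
    | succ k ih =>
      intro hk
      have ih := ih (by omega)
      obtain ⟨j, hj⟩ : ∃ j, i - k = j + 1 := ⟨i - k - 1, by omega⟩
      rw [hj] at ih
      rw [show i - (k + 1) = j by omega]
      let S : CategoryTheory.ShortComplex (ModuleCat.{v} R) :=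
        .mk (ModuleCat.ofHom (F.syzygyMap j)) (ModuleCat.ofHom (range (F.d j)).mkQ) (by
          rw [← ModuleCat.ofHom_comp, (F.exact_syzygyMap_mkQ j).linearMap_comp_eq_zero]; rfl)
      have hS : S.ShortExact := ModuleCat.shortComplex_shortExact S (F.exact_syzygyMap_mkQ j)
        (F.syzygyMap_injective j) (Submodule.mkQ_surjective _)
      have : CategoryTheory.Projective (ModuleCat.of R (F.G j)) :=
        (IsProjective.iff_projective (F.G j)).1 inferInstance
      exact hS.hasProjectiveDimensionLT_X₃ (k + 1) ih
        (CategoryTheory.hasProjectiveDimensionLT_of_ge (ModuleCat.of R (F.G j)) 1 _ (by omega))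
  have := key i le_rfl
  rw [Nat.sub_self] at this
  exact CategoryTheory.hasProjectiveDimensionLT_of_iso F.syzygyZeroEquiv.toModuleIso _

theorem nontrivial_syzygy [Small.{v} R]
    (hpd : CategoryTheory.projectiveDimension (ModuleCat.of R M) = ⊤) (i : ℕ) :
    Nontrivial (F.syzygy i) := by
  by_contra h
  rw [not_nontrivial_iff_subsingleton] at h
  exact (CategoryTheory.projectiveDimension_ne_top_iff _).2
    ⟨i, F.hasProjectiveDimensionLT_of_subsingleton h⟩ hpd

open TensorProduct in
theorem exists_rank_syzygy :
    ∃ r : ℕ → ℤ, (∀ i, r i + r (i + 1) = F.betti i) ∧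
      ∀ (p : Ideal R) [p.IsPrime], Subsingleton (Localization.AtPrime p ⊗[R] M) → ∀ i,
        Module.Free (Localization.AtPrime p) (Localization.AtPrime p ⊗[R] F.syzygy i) ∧
        (Module.finrank (Localization.AtPrime p) (Localization.AtPrime p ⊗[R] F.syzygy i) : ℤ) =
          r i := by
  -- The recursion starts at 0 because `M` localizes to zero; it does not involve `p`.
  let r : ℕ → ℤ := fun i => Nat.rec 0 (fun i x => F.betti i - x) i
  refine ⟨r, fun i => by change r i + (F.betti i - r i) = _; ring, fun p _ hp i => ?_⟩
  set A := Localization.AtPrime p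
  induction i with
  | zero =>
    have : Subsingleton (A ⊗[R] F.syzygy 0) :=
      (F.syzygyZeroEquiv.lTensor A).toEquiv.subsingleton
    exact ⟨inferInstance, by rw [Module.finrank_zero_of_subsingleton]; rfl⟩
  | succ i ih =>
    obtain ⟨hfree, hrank⟩ := ih
    let f := (F.syzygyMap i).baseChange A
    -- As `A ⊗ Ω_i` is free, the sequence splits, so `A ⊗ Ω_(i+1)` is a summand of a free module,
    -- hence free over the local ring `A`.
    let g := (range (F.d i)).mkQ.baseChange A
    have hf : Function.Injective f :=
      Module.Flat.lTensor_preserves_injective_linearMap _ (F.syzygyMap_injective i)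
    have hg : Function.Surjective g := lTensor_surjective A (Submodule.mkQ_surjective _)
    have hfg : Function.Exact f g := Module.Flat.lTensor_exact A (F.exact_syzygyMap_mkQ i)
    obtain ⟨s, hs⟩ := Module.projective_lifting_property g LinearMap.id hg
    let e := (hfg.splitSurjectiveEquiv hf ⟨s, hs⟩).1
    have hproj : Module.Projective A (A ⊗[R] F.syzygy (i + 1)) :=
      .of_split (e.symm.toLinearMap ∘ₗ inl A _ _) (fst A _ _ ∘ₗ e.toLinearMap) (by ext; simp)
    have hfree' : Module.Free A (A ⊗[R] F.syzygy (i + 1)) :=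
      Module.free_of_flat_of_isLocalRing
    refine ⟨hfree', ?_⟩
    have h := e.finrank_eq
    rw [Module.finrank_prod, Module.finrank_baseChange] at h
    change _ = (F.betti i : ℤ) - r i
    rw [← hrank, MinimalFreeResolution.betti, h]
    push_cast
    ring

theorem exists_mem_support_syzygy_iff (hM : IsFiniteLength R M) :
    ∃ r : ℕ → ℤ, (∀ i, r i + r (i + 1) = F.betti i) ∧
      ∀ (p : PrimeSpectrum R), ¬ p.asIdeal.IsMaximal → ∀ i, 0 ≤ r i ∧
        (p ∈ Module.support R (F.syzygy i) ↔ 0 < r i) := by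
  obtain ⟨r, hr, h⟩ := F.exists_rank_syzygy
  refine ⟨r, hr, fun p hp i => ?_⟩
  have hpM : p ∉ Module.support R M := fun h => hp (hM.isMaximal_of_mem_support p h)
  rw [Module.mem_support_iff_nontrivial_tensorProduct, not_nontrivial_iff_subsingleton] at hpM
  obtain ⟨hfree, hrank⟩ := h p.asIdeal hpM i
  rw [Module.mem_support_iff_nontrivial_tensorProduct, ← hrank]
  refine ⟨by positivity, ?_⟩
  rw [Nat.cast_pos, Module.finrank_pos_iff_of_free]


theorem isFiniteLength_syzygy_of_rank_eq_zero [IsNoetherianRing R] {r : ℕ → ℤ}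
    (h : ∀ (p : PrimeSpectrum R), ¬ p.asIdeal.IsMaximal → ∀ i, 0 ≤ r i ∧
      (p ∈ Module.support R (F.syzygy i) ↔ 0 < r i)) {i : ℕ} (hi : r i = 0) :
    IsFiniteLength R (F.syzygy i) := by
  refine .of_support_isMaximal fun p hp => ?_
  by_contra hpm
  rw [(h p hpm i).2, hi] at hp
  exact lt_irrefl _ hp

theorem support_syzygy_eq_univ {r : ℕ → ℤ}
    (h : ∀ (p : PrimeSpectrum R), ¬ p.asIdeal.IsMaximal → ∀ i, 0 ≤ r i ∧
      (p ∈ Module.support R (F.syzygy i) ↔ 0 < r i)) {i : ℕ} [Nontrivial (F.syzygy i)]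
    (hi : (∃ p : PrimeSpectrum R, ¬ p.asIdeal.IsMaximal) → 0 < r i) :
    Module.support R (F.syzygy i) = Set.univ := by
  refine Set.eq_univ_of_forall fun p => ?_
  by_cases hp : p.asIdeal.IsMaximal
  · have : p = IsLocalRing.closedPoint R :=
      PrimeSpectrum.ext (IsLocalRing.eq_maximalIdeal hp)
    exact this ▸ IsLocalRing.closedPoint_mem_support R _
  · exact (h p hp i).2.2 (hi ⟨p, hp⟩)

/-- If two syzygies at distance two have finite length and the differential between the free modules
in between is square, then the length strictly drops. -/
theorem length_syzygy_add_two_lt [IsNoetherianRing R] (hR : ¬ IsFiniteLength R R) {i : ℕ}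
    [Nontrivial (F.syzygy i)] (hi : IsFiniteLength R (F.syzygy i))
    (hb : F.betti (i + 1) = F.betti i) :
    Module.length R (F.syzygy (i + 2)) < Module.length R (F.syzygy i) := by
  have : Nontrivial (F.G i) := (Submodule.mkQ_surjective (range (F.d i))).nontrivial
  rw [length_syzygy_add_two]
  exact LinearMap.length_ker_lt_length_coker hR hb (F.d i) hi (F.minimal i)

/-- Infinite descent on lengths: two vanishing ranks at distance two make the Betti numbers between
them equal. -/
theorem exists_rank_syzygy_pos [IsNoetherianRing R] (hR : ¬ IsFiniteLength R R)
    (hnt : ∀ i, Nontrivial (F.syzygy i)) {r : ℕ → ℤ} (hr : ∀ i, r i + r (i + 1) = F.betti i)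
    (h : ∀ (p : PrimeSpectrum R), ¬ p.asIdeal.IsMaximal → ∀ i, 0 ≤ r i ∧
      (p ∈ Module.support R (F.syzygy i) ↔ 0 < r i)) (j : ℕ) : ∃ k, r (j + 2 * k) ≠ 0 := by
  by_contra! h0
  have hlt (k : ℕ) : Module.length R (F.syzygy (j + 2 * (k + 1))) <
      Module.length R (F.syzygy (j + 2 * k)) := by
    refine F.length_syzygy_add_two_lt (i := j + 2 * k) hR (F.isFiniteLength_syzygy_of_rank_eq_zero h (h0 k)) ?_
    have h1 := hr (j + 2 * k)
    have h2 := hr (j + 2 * k + 1)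
    have h3 : r (j + 2 * k + 1 + 1) = 0 := h0 (k + 1)
    rw [h0 k] at h1
    rw [h3] at h2
    omega
  exact (RelEmbedding.natGT (fun k => Module.length R (F.syzygy (j + 2 * k))) hlt).not_wellFounded
    wellFounded_lt

/-- If the Betti numbers are eventually non-decreasing, then all high syzygies have positive rank
on the punctured spectrum. -/
theorem eventually_rank_syzygy_pos [IsNoetherianRing R] (hR : ¬ IsFiniteLength R R)
    (hnt : ∀ i, Nontrivial (F.syzygy i)) {r : ℕ → ℤ} (hr : ∀ i, r i + r (i + 1) = F.betti i)
    (h : ∀ (p : PrimeSpectrum R), ¬ p.asIdeal.IsMaximal → ∀ i, 0 ≤ r i ∧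
      (p ∈ Module.support R (F.syzygy i) ↔ 0 < r i)) (h0 : ∀ i, 0 ≤ r i)
    {n : ℕ} (hn : ∀ i ≥ n, F.betti i ≤ F.betti (i + 1)) : ∃ N, ∀ i ≥ N, 0 < r i := by
  have hstep (i : ℕ) (hi : n ≤ i) : r i ≤ r (i + 2) := by
    have h1 := hr i
    have h2 := hr (i + 1)
    have h3 := hn i hi
    rw [show i + 1 + 1 = i + 2 from rfl] at h2
    omega
  have hmono (i : ℕ) (hi : n ≤ i) (m : ℕ) : r i ≤ r (i + 2 * m) := by
    induction m with
    | zero => rfl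
    | succ m ih => exact ih.trans (hstep _ (by omega))
  obtain ⟨a, ha⟩ := F.exists_rank_syzygy_pos hR hnt hr h n
  obtain ⟨b, hb⟩ := F.exists_rank_syzygy_pos hR hnt hr h (n + 1)
  -- Beyond the positive ranks at both `n + 2 * a` and `n + 1 + 2 * b`, one for each parity.
  refine ⟨n + 1 + 2 * a + 2 * b, fun i hi => ?_⟩
  have hpos {c : ℕ} (hc : n ≤ c) (h : r c ≠ 0) (m : ℕ) (hm : i = c + 2 * m) : 0 < r i :=
    hm ▸ ((h0 c).lt_of_ne' h).trans_le (hmono c hc m)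
  rcases Nat.even_or_odd' (i - n) with ⟨m, hm | hm⟩
  · exact hpos (by omega) ha (m - a) (by omega)
  · exact hpos (by omega) hb (m - b) (by omega)

end MinimalFreeResolution

theorem proposition5p7 {R : Type u} [CommRing R] [IsLocalRing R] [IsNoetherianRing R]
    [Small.{v} R] {M : Type v} [AddCommGroup M] [Module R M]
    (hM : IsFiniteLength R M)
    (hpd : CategoryTheory.projectiveDimension (ModuleCat.of R M) = ⊤)
    (F : MinimalFreeResolution R M)
    (hβ : ∃ n : ℕ, ∀ i ≥ n, F.betti i ≤ F.betti (i + 1)) :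
    (∃ N : ℕ, ∀ i ≥ N, ∃ p ∈ minimalPrimes R,
      Module.supportDim R (F.syzygy i) = ringKrullDim (R ⧸ p)) ∧
    (0 < ringKrullDim R → ¬ ∀ N : ℕ, ∃ i ≥ N, IsFiniteLength R (F.syzygy i)) := by
  have hnt := F.nontrivial_syzygy hpd
  obtain ⟨r, hr, h⟩ := F.exists_mem_support_syzygy_iff hM
  obtain ⟨n, hn⟩ := hβ
  -- Positivity is conditional because the ranks carry no information when every prime is maximal.
  have hpos : ∃ N, ∀ i ≥ N, (∃ p : PrimeSpectrum R, ¬ p.asIdeal.IsMaximal) → 0 < r i := by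
    by_cases hp : ∃ p : PrimeSpectrum R, ¬ p.asIdeal.IsMaximal
    · obtain ⟨p, hp⟩ := hp
      have hR : ¬ IsFiniteLength R R := fun hR => hp <| hR.isMaximal_of_mem_support p <| by
        simp [Module.mem_support_iff_of_finite, Module.annihilator_eq_bot.2]
      obtain ⟨N, hN⟩ := F.eventually_rank_syzygy_pos hR hnt hr h (fun i => (h p hp i).1) hn
      exact ⟨N, fun i hi _ => hN i hi⟩
    · exact ⟨0, fun i _ h => absurd h hp⟩
  obtain ⟨N, hN⟩ := hpos
  have hsupp (i : ℕ) (hi : N ≤ i) := F.support_syzygy_eq_univ h (hN i hi)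
  refine ⟨⟨N, fun i hi => Module.exists_supportDim_eq_of_support_eq_univ (hsupp i hi)⟩,
    fun hdim hfin => ?_⟩
  obtain ⟨i, hi, hfl⟩ := hfin N
  -- Full support contains the non-maximal prime `p`, which finite length forbids.
  obtain ⟨p, q, hpq⟩ := Order.krullDim_pos_iff.1 hdim
  have hp := hfl.isMaximal_of_mem_support p (hsupp i hi ▸ Set.mem_univ p)
  exact hpq.ne (PrimeSpectrum.ext (hp.eq_of_le q.2.ne_top hpq.le))
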